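/- Theorem 3.3. A graphic sequence is a non-increasing sequence $\pi=(d_1,d_2,\dots,d_n)$ of nonnegative integers that is the degree sequence of some finite simple graph of order $n$ (a realization of $\pi$). For a graph $H$, a graphic sequence is potentially $H$-graphic if it has a realization that contains $H$ as a (not necessarily induced) subgraph. Let $K_5-K_3$ be the graph obtained from the complete graph $K_5$ by removing the three edges of a triangle, and let $r^t$ in a sequence mean that the term $r$ is repeated $t$ times. Let $n\ge 5$ and let $\pi=(d_1,d_2,\dots,d_n)$ be a graphic sequence without zero terms, i.e. $d_n\ge 1$. Then $\pi$ is potentially $K_5-K_3$-graphic if and only if both of the following conditions hold: (1) $d_2\ge 4$ and $d_5\ge 2$; (2) $\pi\ne(4^2,2^4)$, $\pi\ne(4^2,2^5)$, $\pi\ne(4^3,2^3)$ and $\pi\ne(4^6)$. -/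

import Mathlib

open Classical in
/-- `G`, a simple graph on the `n` vertices `Fin n`, is a realization of `d = (d_1, …, d_n)`:
its degree sequence is `d` (the term `d_i` is `d (i - 1)`, since `Fin n` starts at `0`). -/
def IsRealization {n : ℕ} (G : SimpleGraph (Fin n)) (d : Fin n → ℕ) : Prop :=
  ∀ i, G.degree i = d i

/-- `d` is a graphic sequence: a non-increasing sequence of nonnegative integers which is the
degree sequence of some simple graph of order `n`. -/
def IsGraphic {n : ℕ} (d : Fin n → ℕ) : Prop :=
  Antitone d ∧ ∃ G : SimpleGraph (Fin n), IsRealization G d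

/-- `d` is potentially `H`-graphic: it is graphic and has a realization containing `H` as a
(not necessarily induced) subgraph. -/
def IsPotentiallyGraphic {V : Type*} (H : SimpleGraph V) {n : ℕ} (d : Fin n → ℕ) : Prop :=
  Antitone d ∧ ∃ G : SimpleGraph (Fin n), IsRealization G d ∧ H.IsContained G

/-- `K_5 - K_3`: the complete graph on five vertices with the edges of a triangle (the complete
graph on the first three of the vertices) removed. -/
def K5MinusK3 : SimpleGraph (Fin 5) :=
  (⊤ : SimpleGraph (Fin 5)) \
    (⊤ : SimpleGraph (Fin 3)).map (Fin.castLEEmb (by norm_num : 3 ≤ 5))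

/-! Call a copy of `K_5 - K_3` a book: two adjacent hubs with three common neighbours, the pages.
Its hubs have degree at least 4 and its pages degree at least 2, which gives condition (1). In the
exceptional sequences the hubs have no neighbours outside the book, and counting the possible
neighbours of a vertex off the book (`degree_bounds_of_book`) leaves it too small a degree.

For sufficiency, let `u`, `v` have the two largest degrees. One switch makes them adjacent
(`exists_adj_of_top`); among all realizations containing the edge `uv`, take one with the most
common neighbours of `u` and `v` (`IsMaxPair`). If there are three, they form a book with `u`, `v`.
Otherwise both hubs have private neighbours, and maximality is strong: a private neighbour `a` of
`u` and a private neighbour `b` of `v` have the same neighbours off `u, v, a, b`, since any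
difference would allow a switch that gains a common neighbour.

If `u` has two private neighbours, every `a` is joined to every `b`, and a book appears on two
private neighbours as hubs or after one exchange (`IsMaxPair.exists_book_of_two_le_card`). Otherwise
all degrees are at most 4, and `u, v`, their common neighbours `c, d` and the private `a, b` form an
`IsCore`. There an explicit exchange of edges yields a book, unless the structure is so rigid that
the whole graph is determined up to the four exceptional degree sequences
(`IsCore.exists_book_of_not_adj`, `IsCore.exists_book_of_adj`). -/

open Finset

/-! ### Books and degree-preserving exchanges of edges -/

namespace SimpleGraph

variable {V : Type*}

/-- Two adjacent hubs with three common neighbours, the pages: a copy of `K_5 - K_3`. -/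
def HasBook (G : SimpleGraph V) : Prop :=
  ∃ u v x y z, x ≠ y ∧ x ≠ z ∧ y ≠ z ∧ G.Adj u v ∧ G.Adj u x ∧ G.Adj u y ∧ G.Adj u z ∧
    G.Adj v x ∧ G.Adj v y ∧ G.Adj v z

/-- The graph `G` after removal of the edges listed in `L` and addition of those listed in `M`,
where the lists name vertices by their indices under `f`. -/
def exchange (G : SimpleGraph V) {k : ℕ} (f : Fin k → V) (L M : List (Fin k × Fin k)) :
    SimpleGraph V where
  Adj x y := (G.Adj x y ∧ ¬ ∃ i j, f i = x ∧ f j = y ∧ ((i, j) ∈ L ∨ (j, i) ∈ L)) ∨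
    (x ≠ y ∧ ∃ i j, f i = x ∧ f j = y ∧ ((i, j) ∈ M ∨ (j, i) ∈ M))
  symm := ⟨by
    rintro x y (⟨h, h'⟩ | ⟨h, i, j, h1, h2, h3⟩)
    · exact Or.inl ⟨h.symm, fun ⟨i, j, h1, h2, h3⟩ => h' ⟨j, i, h2, h1, h3.symm⟩⟩
    · exact Or.inr ⟨h.symm, j, i, h2, h1, h3.symm⟩⟩
  loopless := ⟨by
    rintro x (⟨h, -⟩ | ⟨h, -⟩)
    · exact G.irrefl h
    · exact h rfl⟩

/-- `L` and `M` meet every index equally often, and list edges in increasing order. -/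
abbrev Balanced {k : ℕ} (L M : List (Fin k × Fin k)) : Prop :=
  (∀ p ∈ M, p.1 < p.2) ∧
  ∀ i, #{j | (i, j) ∈ L ∨ (j, i) ∈ L} = #{j | (i, j) ∈ M ∨ (j, i) ∈ M}

theorem exchange_adj {G : SimpleGraph V} {k : ℕ} {f : Fin k → V} {L M : List (Fin k × Fin k)}
    {x y : V} : (G.exchange f L M).Adj x y ↔
      (G.Adj x y ∧ ¬ ∃ i j, f i = x ∧ f j = y ∧ ((i, j) ∈ L ∨ (j, i) ∈ L)) ∨
      (x ≠ y ∧ ∃ i j, f i = x ∧ f j = y ∧ ((i, j) ∈ M ∨ (j, i) ∈ M)) := Iff.rfl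

theorem exchange_adj_of_mem {G : SimpleGraph V} {k : ℕ} {f : Fin k → V} (hf : Function.Injective f)
    {L M : List (Fin k × Fin k)} (hbal : Balanced L M) {p : Fin k × Fin k} (hp : p ∈ M) :
    (G.exchange f L M).Adj (f p.1) (f p.2) :=
  Or.inr ⟨fun e => (hbal.1 p hp).ne (hf e), p.1, p.2, rfl, rfl, Or.inl hp⟩

theorem exchange_adj_of_notMem {G : SimpleGraph V} {k : ℕ} {f : Fin k → V} (hf : Function.Injective f)
    {L M : List (Fin k × Fin k)} {p : Fin k × Fin k} (h : G.Adj (f p.1) (f p.2))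
    (hp : p ∉ L) (hp' : p.swap ∉ L) : (G.exchange f L M).Adj (f p.1) (f p.2) := by
  refine Or.inl ⟨h, ?_⟩
  rintro ⟨i, j, h1, h2, h3⟩
  obtain rfl := hf h1
  obtain rfl := hf h2
  exact h3.elim hp hp'

open Classical in
/-- Every vertex has the same degree in both graphs. -/
def SameDegrees [Fintype V] (G H : SimpleGraph V) : Prop := ∀ x, H.degree x = G.degree x

variable [Fintype V] {G : SimpleGraph V}

theorem SameDegrees.trans {G₁ G₂ G₃ : SimpleGraph V} (h : SameDegrees G₁ G₂)
    (h' : SameDegrees G₂ G₃) : SameDegrees G₁ G₃ := fun x => (h' x).trans (h x)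

open Classical in
-- A listed vertex loses its partners in `L`, all of them neighbours, and gains its partners in `M`,
-- none of them neighbours; balance makes the two numbers equal. Unlisted vertices keep their
-- neighbourhoods.
theorem sameDegrees_exchange {k : ℕ} {f : Fin k → V} (hf : Function.Injective f)
    {L M : List (Fin k × Fin k)} (hbal : Balanced L M)
    (hL : ∀ p ∈ L, G.Adj (f p.1) (f p.2)) (hM : ∀ p ∈ M, ¬ G.Adj (f p.1) (f p.2)) :
    SameDegrees G (G.exchange f L M) := by
  intro x
  have hL' : ∀ i j, (i, j) ∈ L ∨ (j, i) ∈ L → G.Adj (f i) (f j) := by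
    rintro i j (h | h)
    · exact hL _ h
    · exact (hL _ h).symm
  have hM' : ∀ i j, (i, j) ∈ M ∨ (j, i) ∈ M → ¬ G.Adj (f i) (f j) := by
    rintro i j (h | h)
    · exact hM _ h
    · exact fun h' => hM _ h h'.symm
  have hM'' : ∀ i j, (i, j) ∈ M ∨ (j, i) ∈ M → f i ≠ f j := by
    rintro i j (h | h)
    · exact fun e => (hbal.1 _ h).ne (hf e)
    · exact fun e => (hbal.1 _ h).ne (hf e.symm)
  rw [← card_neighborFinset_eq_degree, ← card_neighborFinset_eq_degree]
  by_cases hx : ∃ i, f i = x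
  · obtain ⟨i, rfl⟩ := hx
    set S : Finset V := ({j | (i, j) ∈ L ∨ (j, i) ∈ L} : Finset (Fin k)).image f with hS
    set S' : Finset V := ({j | (i, j) ∈ M ∨ (j, i) ∈ M} : Finset (Fin k)).image f with hS'
    have hc : #S = #S' := by
      rw [hS, hS', card_image_of_injective _ hf, card_image_of_injective _ hf, hbal.2 i]
    have hsub : S ⊆ G.neighborFinset (f i) := by
      intro y hy
      simp only [hS, mem_image, mem_filter, mem_univ, true_and] at hy
      obtain ⟨j, hj, rfl⟩ := hy
      simpa using hL' i j hj
    have hdis : Disjoint (G.neighborFinset (f i) \ S) S' := by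
      rw [Finset.disjoint_left]
      intro y hy hy'
      simp only [hS', mem_image, mem_filter, mem_univ, true_and] at hy'
      obtain ⟨j, hj, rfl⟩ := hy'
      simp only [mem_sdiff, mem_neighborFinset] at hy
      exact hM' i j hj hy.1
    have heq : (G.exchange f L M).neighborFinset (f i) = (G.neighborFinset (f i) \ S) ∪ S' := by
      ext y
      simp only [mem_neighborFinset, exchange_adj, mem_union, mem_sdiff, hS, hS', mem_image,
        mem_filter, mem_univ, true_and]
      constructor
      · rintro (⟨h, h'⟩ | ⟨-, i', j, h1, h2, h3⟩)
        · exact Or.inl ⟨h, fun ⟨j, hj, e⟩ => h' ⟨i, j, rfl, e, hj⟩⟩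
        · obtain rfl := hf h1
          exact Or.inr ⟨j, h3, h2⟩
      · rintro (⟨h, h'⟩ | ⟨j, hj, rfl⟩)
        · refine Or.inl ⟨h, ?_⟩
          rintro ⟨i', j, h1, h2, h3⟩
          obtain rfl := hf h1
          exact h' ⟨j, h3, h2⟩
        · exact Or.inr ⟨hM'' i j hj, i, j, rfl, rfl, hj⟩
    rw [heq, card_union_of_disjoint hdis, card_sdiff_of_subset hsub, hc]
    have := card_le_card hsub
    omega
  · congr 1
    ext y
    simp only [mem_neighborFinset, exchange_adj]
    constructor
    · rintro (⟨h, -⟩ | ⟨-, i, j, h1, -⟩)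
      · exact h
      · exact absurd ⟨i, h1⟩ hx
    · exact fun h => Or.inl ⟨h, fun ⟨i, j, h1, _⟩ => hx ⟨i, h1⟩⟩

/-- The edges of the book with hubs `0, 1` and pages `2, 3, 4`. -/
abbrev bookEdges (k : ℕ) : List (Fin (k + 5) × Fin (k + 5)) :=
  [(0, 1), (0, 2), (0, 3), (0, 4), (1, 2), (1, 3), (1, 4)]

/-- An exchange of edges that creates the book on the first five listed vertices. -/
theorem exists_book_of_exchange {k : ℕ} {l : List V} (hlen : l.length = k + 5) (hnd : l.Nodup)
    (L M : List (Fin (k + 5) × Fin (k + 5)))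
    (hbal : Balanced L M) (hbook : ∀ p ∈ bookEdges k, p ∉ L ∧ p.swap ∉ L)
    (hL : ∀ p ∈ L, G.Adj (l.get (p.1.cast hlen.symm)) (l.get (p.2.cast hlen.symm)))
    (hM : ∀ p ∈ M, ¬ G.Adj (l.get (p.1.cast hlen.symm)) (l.get (p.2.cast hlen.symm)))
    (hK : ∀ p ∈ bookEdges k, p ∈ M ∨
      G.Adj (l.get (p.1.cast hlen.symm)) (l.get (p.2.cast hlen.symm))) :
    ∃ H, SameDegrees G H ∧ H.HasBook := by
  set f : Fin (k + 5) → V := fun i => l.get (i.cast hlen.symm) with hfdef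
  have hf : Function.Injective f := fun i j h => by
    have := hnd.injective_get h
    simpa using this
  refine ⟨_, sameDegrees_exchange hf hbal hL hM, ?_⟩
  have key : ∀ p ∈ bookEdges k, (G.exchange f L M).Adj (f p.1) (f p.2) := by
    intro p hp
    rcases hK p hp with h | h
    · exact exchange_adj_of_mem hf hbal h
    · exact exchange_adj_of_notMem hf h (hbook p hp).1 (hbook p hp).2
  have hlt : ∀ i j : ℕ, i < j → j < 5 → (⟨i % (k + 5), Nat.mod_lt _ (by omega)⟩ : Fin (k + 5)) ≠
      ⟨j % (k + 5), Nat.mod_lt _ (by omega)⟩ := fun i j h h' e => by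
    rw [Fin.mk.injEq, Nat.mod_eq_of_lt (by omega), Nat.mod_eq_of_lt (by omega)] at e
    omega
  have h1 : (2 : Fin (k + 5)) ≠ 3 := hlt 2 3 (by omega) (by omega)
  have h2 : (2 : Fin (k + 5)) ≠ 4 := hlt 2 4 (by omega) (by omega)
  have h3 : (3 : Fin (k + 5)) ≠ 4 := hlt 3 4 (by omega) (by omega)
  exact ⟨f 0, f 1, f 2, f 3, f 4, hf.ne h1, hf.ne h2, hf.ne h3, key (0, 1) (by simp),
    key (0, 2) (by simp), key (0, 3) (by simp), key (0, 4) (by simp), key (1, 2) (by simp),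
    key (1, 3) (by simp), key (1, 4) (by simp)⟩

/-- Switching of the edges `pq`, `rs` into `pr`, `qs`. -/
theorem exists_switch {p q r s : V} (hpq : G.Adj p q) (hrs : G.Adj r s) (hpr : ¬ G.Adj p r)
    (hqs : ¬ G.Adj q s) (npr : p ≠ r) (nqs : q ≠ s) :
    ∃ H, SameDegrees G H ∧ ∀ x y, H.Adj x y ↔
      (G.Adj x y ∧ ¬ (x = p ∧ y = q ∨ x = q ∧ y = p ∨ x = r ∧ y = s ∨ x = s ∧ y = r)) ∨
      (x = p ∧ y = r ∨ x = r ∧ y = p ∨ x = q ∧ y = s ∨ x = s ∧ y = q) := by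
  have n1 := hpq.ne
  have n2 := hrs.ne
  have n3 : p ≠ s := by rintro rfl; exact hqs hpq.symm
  have n4 : q ≠ r := by rintro rfl; exact hpr hpq
  have hf : Function.Injective ![p, q, r, s] := by
    intro i j h
    fin_cases i <;> fin_cases j <;> simp_all
  refine ⟨_, sameDegrees_exchange (G := G) hf (L := [(0, 1), (2, 3)]) (M := [(0, 2), (1, 3)])
    (by decide) (by simp [hpq, hrs]) (by simp [hpr, hqs]), fun x y => ?_⟩
  simp [exchange_adj, Fin.exists_fin_succ]
  grind

end SimpleGraph

/-! ### Edges with the maximal number of common neighbours -/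

namespace SimpleGraph

variable {V : Type*} [Fintype V] {G : SimpleGraph V}

/-- `uv` is an edge with as many common neighbours as it can have with these degrees. -/
def IsMaxPair (G : SimpleGraph V) (u v : V) : Prop :=
  G.Adj u v ∧ ∀ H, SameDegrees G H → H.Adj u v →
    (H.commonNeighbors u v).ncard ≤ (G.commonNeighbors u v).ncard

theorem IsMaxPair.symm {u v : V} (h : G.IsMaxPair u v) : G.IsMaxPair v u :=
  ⟨h.1.symm, fun H h1 h2 => by
    rw [commonNeighbors_symm H, commonNeighbors_symm G]; exact h.2 H h1 h2.symm⟩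

theorem IsMaxPair.false_of_gain {u v x : V} (h : G.IsMaxPair u v) {H : SimpleGraph V}
    (hH : SameDegrees G H) (huv : H.Adj u v)
    (hc : ∀ w, G.Adj u w → G.Adj v w → H.Adj u w ∧ H.Adj v w)
    (hx : ¬ (G.Adj u x ∧ G.Adj v x)) (hux : H.Adj u x) (hvx : H.Adj v x) : False := by
  have hlt : (G.commonNeighbors u v).ncard < (H.commonNeighbors u v).ncard := by
    refine Set.ncard_lt_ncard ⟨fun w hw => hc w hw.1 hw.2, fun hs => hx (hs ⟨hux, hvx⟩)⟩
      (Set.toFinite _)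
  exact (h.2 H hH huv).not_gt hlt

/-- Neighbours of a private neighbour `a` of `u` are neighbours of each private neighbour of `v`. -/
theorem IsMaxPair.adj_of_adj {u v a b z : V} (h : G.IsMaxPair u v) (hua : G.Adj u a)
    (hva : ¬ G.Adj v a) (hvb : G.Adj v b) (hub : ¬ G.Adj u b) (nav : a ≠ v)
    (nbu : b ≠ u) (nzu : z ≠ u) (nzb : z ≠ b) (haz : G.Adj a z) : G.Adj b z := by
  by_contra hbz
  -- Trading `vb`, `az` for `va`, `bz` loses no common neighbour, as `b` was private, and gains `a`.
  obtain ⟨H, hH, hadj⟩ := exists_switch hvb haz hva hbz nav.symm nzb.symm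
  have huv := h.1
  have n1 := huv.ne
  have n2 := hua.ne
  have n3 := hvb.ne
  have nzv : z ≠ v := by rintro rfl; exact hva haz.symm
  refine h.false_of_gain (x := a) hH ?_ ?_ (by tauto) ?_ ?_
  · rw [hadj]; grind
  · intro w h1 h2
    rw [hadj, hadj]; grind
  · rw [hadj]; grind
  · rw [hadj]; grind

/-- Trading `ua`, `xy` for `ux`, `ay` and then `vb`, `xz` for `vx`, `bz` would make `x` a common
neighbour. The last hypothesis excludes the case in which the added edges `ay` and `bz` coincide. -/
theorem IsMaxPair.false_of_double_switch {u v a b x y z : V} (h : G.IsMaxPair u v)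
    (hua : G.Adj u a) (hva : ¬ G.Adj v a) (hvb : G.Adj v b) (hub : ¬ G.Adj u b) (nav : a ≠ v)
    (nbu : b ≠ u) (nxu : x ≠ u) (nxv : x ≠ v) (hux : ¬ G.Adj u x) (hvx : ¬ G.Adj v x)
    (hxy : G.Adj x y) (hxz : G.Adj x z) (nyz : y ≠ z) (hya : ¬ G.Adj a y) (hzb : ¬ G.Adj b z)
    (nya : a ≠ y) (nzb : b ≠ z) (hne : ¬ (y = b ∧ z = a)) : False := by
  obtain ⟨H, hH, hadj⟩ := exists_switch hua hxy hux hya nxu.symm nya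
  have huv := h.1
  have n1 := huv.ne
  have n2 := hua.ne
  have n3 := hvb.ne
  have nzu : z ≠ u := by rintro rfl; exact hux hxz.symm
  have nzv : z ≠ v := by rintro rfl; exact hvx hxz.symm
  have nyu : y ≠ u := by rintro rfl; exact hux hxy.symm
  have nyv : y ≠ v := by rintro rfl; exact hvx hxy.symm
  have n4 := hxy.ne
  have n5 := hxz.ne
  have nax : a ≠ x := by rintro rfl; exact hux hua
  have nbx : b ≠ x := by rintro rfl; exact hvx hvb
  have nab : a ≠ b := by rintro rfl; exact hva hvb
  have k1 : H.Adj v b := by rw [hadj]; grind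
  have k2 : H.Adj x z := by rw [hadj]; grind
  have k3 : ¬ H.Adj v x := by rw [hadj]; grind
  have k4 : ¬ H.Adj b z := by rw [hadj]; grind
  obtain ⟨K, hK, hadj'⟩ := exists_switch k1 k2 k3 k4 nxv.symm nzb
  refine h.false_of_gain (x := x) (hH.trans hK) ?_ ?_ (by tauto) ?_ ?_
  · rw [hadj', hadj]; grind
  · intro w h1 h2
    rw [hadj', hadj', hadj, hadj]; grind
  · rw [hadj', hadj]; grind
  · rw [hadj', hadj]; grind

/-- Replacing `vb`, `at`, `pq` by `va`, `tp`, `bq` makes `a` a common neighbour. -/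
theorem IsMaxPair.false_of_shift {u v a b t p q : V} (h : G.IsMaxPair u v)
    (hua : G.Adj u a) (hva : ¬ G.Adj v a) (hvb : G.Adj v b) (hub : ¬ G.Adj u b) (nav : a ≠ v)
    (nbu : b ≠ u) (hat : G.Adj a t) (ntu : t ≠ u) (hpq : G.Adj p q) (npu : p ≠ u) (npv : p ≠ v)
    (nqu : q ≠ u) (nqv : q ≠ v) (nqa : q ≠ a) (nqb : q ≠ b) (haq : ¬ G.Adj a q)
    (hbq : ¬ G.Adj b q) (htp : ¬ G.Adj t p) (ntp : t ≠ p) : False := by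
  -- The edge `aq` is temporary: this switch creates it, and the second one spends it together with
  -- `vb`.
  obtain ⟨H, hH, hadj⟩ := exists_switch hat hpq.symm haq htp nqa.symm ntp
  have huv := h.1
  have n1 := huv.ne
  have n2 := hua.ne
  have n3 := hvb.ne
  have n4 := hpq.ne
  have ntv : t ≠ v := by rintro rfl; exact hva hat.symm
  have nab : a ≠ b := by rintro rfl; exact hva hvb
  have npa : p ≠ a := by rintro rfl; exact haq hpq
  have k1 : H.Adj v b := by rw [hadj]; grind
  have k2 : H.Adj a q := by rw [hadj]; grind
  have k3 : ¬ H.Adj v a := by rw [hadj]; grind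
  have k4 : ¬ H.Adj b q := by rw [hadj]; grind
  obtain ⟨K, hK, hadj'⟩ := exists_switch k1 k2 k3 k4 nav.symm nqb.symm
  refine h.false_of_gain (x := a) (hH.trans hK) ?_ ?_ (by tauto) ?_ ?_
  · rw [hadj', hadj]; grind
  · intro w h1 h2
    rw [hadj', hadj', hadj, hadj]; grind
  · rw [hadj', hadj]; grind
  · rw [hadj', hadj]; grind

end SimpleGraph

/-! ### The six-vertex core and its explicit exchanges -/

namespace SimpleGraph

variable {V : Type*} {G : SimpleGraph V}

/-- The edge `uv` has just the common neighbours `c, d`, and the hubs have one private neighbour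
each, `a` and `b`, which agree outside these six vertices. -/
structure IsCore (G : SimpleGraph V) (u v a b c d : V) : Prop where
  nodup : [u, v, c, d, a, b].Nodup
  adj_left : ∀ x, G.Adj u x ↔ x = v ∨ x = c ∨ x = d ∨ x = a
  adj_right : ∀ x, G.Adj v x ↔ x = u ∨ x = c ∨ x = d ∨ x = b
  adj_private : ∀ x, x ≠ u → x ≠ v → x ≠ a → x ≠ b → (G.Adj a x ↔ G.Adj b x)

theorem IsCore.swap {u v a b c d : V} (h : G.IsCore u v a b c d) : G.IsCore u v a b d c where
  nodup := by have := h.nodup; simp at this ⊢; grind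
  adj_left x := by rw [h.adj_left]; tauto
  adj_right x := by rw [h.adj_right]; tauto
  adj_private := h.adj_private

variable [Fintype V]

open Classical in
theorem degree_eq_length_of_adj_iff {x : V} (l : List V) (hl : l.Nodup)
    (h : ∀ y, G.Adj x y ↔ y ∈ l) : G.degree x = l.length := by
  rw [← card_neighborFinset_eq_degree, ← List.toFinset_card_of_nodup hl]
  congr 1
  ext y
  simp [h]

open Classical in
theorem adj_iff_mem_of_degree_le {x : V} (l : List V) (hl : l.Nodup)
    (h : ∀ y ∈ l, G.Adj x y) (hdeg : G.degree x ≤ l.length) (y : V) : G.Adj x y ↔ y ∈ l := by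
  have hsub : l.toFinset ⊆ G.neighborFinset x := fun y hy => by simpa using h y (by simpa using hy)
  have := eq_of_subset_of_card_le hsub (by
    rwa [card_neighborFinset_eq_degree, List.toFinset_card_of_nodup hl])
  rw [← mem_neighborFinset, ← this, List.mem_toFinset]

namespace IsCore

variable {u v a b c d w t : V}

/-- Moves available when both common neighbours are joined to the private ones. -/
theorem book_of_adj_adj (h : G.IsCore u v a b c d) (hab : ¬ G.Adj a b) (hac : G.Adj a c)
    (had : G.Adj a d) (hcd : ¬ G.Adj c d) : ∃ H, SameDegrees G H ∧ H.HasBook := by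
  obtain ⟨hn, hu, hv, hp⟩ := h
  have hn' := hn
  simp at hn'
  refine exists_book_of_exchange (k := 1) (l := [u, v, c, d, a, b]) rfl hn
    [(1, 5), (2, 4), (3, 4)] [(1, 4), (4, 5), (2, 3)] (by decide) (by decide) ?_ ?_ ?_ <;>
  simp <;> grind [G.adj_comm]

/-- The new pages are `c, a, b`: `d` gives up `u` and `v`, to which `b` and `a` are joined instead.
The remaining edges restore the two degrees lost at `d` and remove the surplus at `a` and `b`. Most
of the following exchanges share this pattern and differ only in the repair. -/
theorem book_of_page_adj (h : G.IsCore u v a b c d) (hn : [u, v, c, a, b, d, w].Nodup)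
    (hac : G.Adj a c) (haw : G.Adj a w) (had : ¬ G.Adj a d) (hcd : ¬ G.Adj c d)
    (hcw : ¬ G.Adj c w) : ∃ H, SameDegrees G H ∧ H.HasBook := by
  obtain ⟨-, hu, hv, hp⟩ := h
  have hn' := hn
  simp at hn'
  refine exists_book_of_exchange (k := 2) (l := [u, v, c, a, b, d, w]) rfl hn
    [(0, 5), (1, 5), (2, 3), (2, 4), (3, 6)] [(0, 4), (1, 3), (2, 5), (2, 6), (3, 5)]
    (by decide) (by decide) ?_ ?_ ?_ <;>
  simp <;> grind [G.adj_comm]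

theorem book_of_two_outer (h : G.IsCore u v a b c d) (hn : [u, v, c, a, b, d, w, t].Nodup)
    (haw : G.Adj a w) (hat : G.Adj a t) (hdw : ¬ G.Adj d w) (hdt : ¬ G.Adj d t) :
    ∃ H, SameDegrees G H ∧ H.HasBook := by
  obtain ⟨-, hu, hv, hp⟩ := h
  have hn' := hn
  simp at hn'
  refine exists_book_of_exchange (k := 3) (l := [u, v, c, a, b, d, w, t]) rfl hn
    [(0, 5), (1, 5), (3, 6), (4, 7)] [(1, 3), (0, 4), (5, 6), (5, 7)]
    (by decide) (by decide) ?_ ?_ ?_ <;>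
  simp <;> grind [G.adj_comm]

theorem book_of_adj_page (h : G.IsCore u v a b c d) (hab : G.Adj a b) (hac : G.Adj a c)
    (had : ¬ G.Adj a d) (hcd : ¬ G.Adj c d) : ∃ H, SameDegrees G H ∧ H.HasBook := by
  obtain ⟨hn, hu, hv, hp⟩ := h
  have hn : [u, v, c, a, b, d].Nodup := by simp at hn ⊢; grind
  have hn' := hn
  simp at hn'
  refine exists_book_of_exchange (k := 1) (l := [u, v, c, a, b, d]) rfl hn
    [(0, 5), (1, 5), (2, 3), (3, 4)] [(0, 4), (1, 3), (2, 5), (3, 5)]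
    (by decide) (by decide) ?_ ?_ ?_ <;>
  simp <;> grind [G.adj_comm]

theorem book_of_adj_outer (h : G.IsCore u v a b c d) (hn : [u, v, c, a, b, d, w].Nodup)
    (hab : G.Adj a b) (haw : G.Adj a w) (had : ¬ G.Adj a d) (hdw : ¬ G.Adj d w) :
    ∃ H, SameDegrees G H ∧ H.HasBook := by
  obtain ⟨-, hu, hv, hp⟩ := h
  have hn' := hn
  simp at hn'
  refine exists_book_of_exchange (k := 2) (l := [u, v, c, a, b, d, w]) rfl hn
    [(0, 5), (1, 5), (3, 4), (4, 6)] [(0, 4), (1, 3), (4, 5), (5, 6)]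
    (by decide) (by decide) ?_ ?_ ?_ <;>
  simp <;> grind [G.adj_comm]

/-- Here the private vertices `a`, `b` become the hubs, with pages `w`, `t`, `u`; only the edge `bu`
is missing, and `v` absorbs the degree changes. -/
theorem book_of_adj_outer_adj (h : G.IsCore u v a b c d) (hn : [a, b, w, t, u, v].Nodup)
    (hab : G.Adj a b) (haw : G.Adj a w) (hat : G.Adj a t) (hwt : G.Adj w t) (hvw : ¬ G.Adj v w)
    (hvt : ¬ G.Adj v t) : ∃ H, SameDegrees G H ∧ H.HasBook := by
  obtain ⟨hn₀, hu, hv, hp⟩ := h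
  have hn' := hn
  simp at hn' hn₀
  refine exists_book_of_exchange (k := 1) (l := [a, b, w, t, u, v]) rfl hn
    [(4, 5), (1, 5), (2, 3)] [(1, 4), (2, 5), (3, 5)]
    (by decide) (by decide) ?_ ?_ ?_ <;>
  simp <;> grind [G.adj_comm]

theorem book_of_matching (h : G.IsCore u v a b c d) (hn : [u, v, c, a, b, d, w, t].Nodup)
    (haw : G.Adj a w) (hat : G.Adj a t) (hwt : ¬ G.Adj w t) (hcd : ¬ G.Adj c d)
    (hcw : G.Adj c w) (hdw : ¬ G.Adj d w) :
    ∃ H, SameDegrees G H ∧ H.HasBook := by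
  obtain ⟨-, hu, hv, hp⟩ := h
  have hn' := hn
  simp at hn'
  refine exists_book_of_exchange (k := 3) (l := [u, v, c, a, b, d, w, t]) rfl hn
    [(0, 5), (1, 5), (3, 6), (4, 7), (2, 6)] [(1, 3), (0, 4), (5, 6), (2, 5), (6, 7)]
    (by decide) (by decide) ?_ ?_ ?_ <;>
  simp <;> grind [G.adj_comm]

end IsCore

open Classical in
theorem exists_adj_adj_of_two_le_degree {x : V} (h : 2 ≤ G.degree x) :
    ∃ y z, y ≠ z ∧ G.Adj x y ∧ G.Adj x z := by
  rw [← card_neighborFinset_eq_degree] at h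
  obtain ⟨y, hy, z, hz, hne⟩ := one_lt_card.1 h
  exact ⟨y, z, hne, by simpa using hy, by simpa using hz⟩

open Classical in
/-- The degrees of `G`, listed in some order, are one of the four exceptional sequences. -/
def IsExceptional (G : SimpleGraph V) : Prop :=
  ∃ l : List V, l.Nodup ∧ (∀ x, x ∈ l) ∧
    (l.map (fun x => G.degree x) = [4, 4, 2, 2, 2, 2] ∨
      l.map (fun x => G.degree x) = [4, 4, 2, 2, 2, 2, 2] ∨
      l.map (fun x => G.degree x) = [4, 4, 4, 2, 2, 2] ∨
      l.map (fun x => G.degree x) = [4, 4, 4, 4, 4, 4])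

open Classical in
theorem exists_notMem_of_card {p : V → Prop} [DecidablePred p] (l : List V)
    (h : l.length < #{x | p x}) :
    ∃ x, p x ∧ x ∉ l := by
  by_contra! hc
  have : ({x | p x} : Finset V) ⊆ l.toFinset := fun x hx => by simpa using hc x (by simpa using hx)
  exact absurd ((card_le_card this).trans l.toFinset_card_le) (by omega)

end SimpleGraph

/-! ### Case analysis of the core -/

namespace SimpleGraph

variable {V : Type*} [Fintype V] {G : SimpleGraph V}

namespace IsCore

variable {u v a b c d w t : V}

open Classical in
-- Since `a` and `b` agree on `c`, the vertices `u, v, a, b` are four neighbours of `c`, and the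
-- degree bound allows no more.
theorem adj_page_iff (h : G.IsCore u v a b c d) (hdeg : ∀ x, G.degree x ≤ 4) (hac : G.Adj a c)
    (y : V) : G.Adj c y ↔ y = u ∨ y = v ∨ y = a ∨ y = b := by
  obtain ⟨hn, hu, hv, hp⟩ := h
  simp at hn
  have hirr : ∀ x, ¬ G.Adj x x := fun x => G.irrefl
  have := adj_iff_mem_of_degree_le (G := G) (x := c) [u, v, a, b] (by simp; grind)
    (by simp; grind [G.adj_comm]) (by simpa using hdeg c) y
  simpa using this

/-- An outer vertex has at most one neighbour that is not joined to the private neighbours. -/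
theorem false_of_outer (h : G.IsCore u v a b c d) (hmax : G.IsMaxPair u v) {x y z : V}
    (hx : x ∉ [u, v, c, d, a, b]) (hxy : G.Adj x y) (hxz : G.Adj x z) (nyz : y ≠ z)
    (hay : ¬ G.Adj a y) (hbz : ¬ G.Adj b z) (nay : a ≠ y) (nbz : b ≠ z)
    (hne : ¬ (y = b ∧ z = a)) : False := by
  obtain ⟨hn, hu, hv, hp⟩ := h
  simp at hn hx
  exact hmax.false_of_double_switch (a := a) (b := b) (x := x) (y := y) (z := z) (by grind)
    (by grind) (by grind) (by grind) (by grind) (by grind) (by grind) (by grind) (by grind)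
    (by grind) hxy hxz nyz hay hbz nay nbz hne

theorem false_of_edge (h : G.IsCore u v a b c d) (hmax : G.IsMaxPair u v) {p q : V}
    (hat : G.Adj a t) (ntu : t ≠ u)
    (hpq : G.Adj p q) (hp : p ∉ [u, v, a, b]) (hq : q ∉ [u, v, a, b]) (haq : ¬ G.Adj a q)
    (htp : ¬ G.Adj t p) (ntp : t ≠ p) : False := by
  obtain ⟨hn, hu, hv, hp'⟩ := h
  simp at hn hp hq
  exact hmax.false_of_shift (a := a) (b := b) (t := t) (p := p) (q := q) (by grind) (by grind)
    (by grind) (by grind) (by grind) (by grind) hat ntu hpq (by grind) (by grind) (by grind)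
    (by grind) (by grind) (by grind) haq (by grind) htp ntp

open Classical in
-- As `c` is saturated by `u, v, a, b`, either `a` is joined to `d` or any outer vertex `w` serves
-- for an exchange. With neither available the graph has six vertices and is completely known: it
-- realizes `(4^3, 2^3)`.
theorem exists_book_of_not_adj_of_adj_page (h : G.IsCore u v a b c d)
    (hdeg : ∀ x, G.degree x ≤ 4) (hab : ¬ G.Adj a b) (hac : G.Adj a c)
    (hW : ∀ x, x ∉ [u, v, c, d, a, b] → G.Adj a x) :
    (∃ H, SameDegrees G H ∧ H.HasBook) ∨ IsExceptional G := by
  have hn := h.nodup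
  have hu := h.adj_left
  have hv := h.adj_right
  have hp := h.adj_private
  simp at hn
  have hirr : ∀ x, ¬ G.Adj x x := fun x => G.irrefl
  have hc := h.adj_page_iff hdeg hac
  by_cases had : G.Adj a d
  · exact Or.inl (h.book_of_adj_adj hab hac had (by grind))
  by_cases hw : ∃ w, w ∉ [u, v, c, d, a, b]
  · obtain ⟨w, hw⟩ := hw
    have haw := hW w hw
    exact Or.inl (h.book_of_page_adj (w := w) (by simp at hw ⊢; grind) hac haw had (by grind)
      (by simp at hw; grind))
  · push Not at hw
    right
    have hw' := hw
    simp at hw'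
    refine ⟨[u, v, c, d, a, b], h.nodup, hw, Or.inr (Or.inr (Or.inl ?_))⟩
    have e1 : G.degree u = 4 := degree_eq_length_of_adj_iff [v, c, d, a] (by simp; grind)
      (by simpa using hu)
    have e2 : G.degree v = 4 := degree_eq_length_of_adj_iff [u, c, d, b] (by simp; grind)
      (by simpa using hv)
    have e3 : G.degree c = 4 := degree_eq_length_of_adj_iff [u, v, a, b] (by simp; grind)
      (by simpa using hc)
    have e4 : G.degree d = 2 := degree_eq_length_of_adj_iff [u, v] (by simp; grind)
      (by simp; intro y; have := hw' y; grind [G.adj_comm])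
    have e5 : G.degree a = 2 := degree_eq_length_of_adj_iff [u, c] (by simp; grind)
      (by simp; intro y; have := hw' y; grind [G.adj_comm])
    have e6 : G.degree b = 2 := degree_eq_length_of_adj_iff [v, c] (by simp; grind)
      (by simp; intro y; have := hw' y; grind [G.adj_comm])
    simp [e1, e2, e3, e4, e5, e6]

open Classical in
theorem exists_book_of_not_adj (h : G.IsCore u v a b c d) (hmax : G.IsMaxPair u v)
    (hdeg : ∀ x, G.degree x ≤ 4) (hpos : ∀ x, 0 < G.degree x)
    (h5 : 5 ≤ #{x | 2 ≤ G.degree x}) (hab : ¬ G.Adj a b) :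
    (∃ H, SameDegrees G H ∧ H.HasBook) ∨ IsExceptional G := by
  have hn := h.nodup
  have hu := h.adj_left
  have hv := h.adj_right
  have hp := h.adj_private
  simp at hn
  have hirr : ∀ x, ¬ G.Adj x x := fun x => G.irrefl
  have hub : ¬ G.Adj u b := by grind
  have hva : ¬ G.Adj v a := by grind
  have hbu : ¬ G.Adj b u := fun h' => hub h'.symm
  have hav : ¬ G.Adj a v := fun h' => hva h'.symm
  have hba : ¬ G.Adj b a := fun h' => hab h'.symm
  -- Otherwise `a` and `b` are leaves. One of the five vertices of degree at least 2 is none of `u,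
  -- v, c, d`, hence is outer, and its two neighbours allow a double switch.
  have hT : ∃ t, t ≠ u ∧ G.Adj a t := by
    by_contra! hT
    obtain ⟨x, hx, hxl⟩ := exists_notMem_of_card [u, v, c, d] h5
    obtain ⟨y, z, hne, hy, hz⟩ := exists_adj_adj_of_two_le_degree hx
    have hb : ∀ z, G.Adj b z → z = v := by
      intro z hz
      by_contra hzv
      have hzu : z ≠ u := by rintro rfl; exact hbu hz
      exact hT z hzu ((hp z hzu hzv (by rintro rfl; exact hba hz) hz.ne').2 hz)
    by_cases hxa : x = a
    · grind
    by_cases hxb : x = b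
    · grind
    · simp at hxl
      have hux : ¬ G.Adj u x := by grind
      have hvx : ¬ G.Adj v x := by grind
      have hax : ¬ G.Adj a x := by grind
      have hbx : ¬ G.Adj b x := by grind
      exact h.false_of_outer hmax (x := x) (y := y) (z := z) (by simp; grind) hy hz hne
        (hT y (by grind [G.adj_comm])) (fun hbz => by grind [G.adj_comm])
        (by grind [G.adj_comm]) (by grind [G.adj_comm]) (by grind [G.adj_comm])
  obtain ⟨t, htu, hat⟩ := hT
  -- Such an `x` is joined to `b` too, so `b` and a stray neighbour `y` would feed the double
  -- switch.
  have hTW : ∀ x y, x ∉ [u, v, c, d, a, b] → G.Adj a x → G.Adj x y → y = a ∨ y = b ∨ G.Adj a y := by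
    intro x y hx hax hxy
    by_contra! hc
    have hx' := hx
    simp at hx'
    have hbx : G.Adj b x := by grind
    refine h.false_of_outer hmax (x := x) (y := b) (z := y) hx hbx.symm hxy
      (by grind) hab (fun hby => ?_) (by grind) (by grind) (by grind)
    have hyu : y ≠ u := by rintro rfl; exact hbu hby
    have hyv : y ≠ v := by rintro rfl; grind [G.adj_comm]
    grind
  -- The edge `pq` would be shifted along `t`. That `t` is not joined to `p` follows from saturation
  -- if `t` is `c` or `d`, and from `hTW` if `t` is outer.
  have hR : ∀ p q, G.Adj p q → p ∉ [u, v, a, b] → q ∉ [u, v, a, b] → ¬ G.Adj a p →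
      ¬ G.Adj a q → False := by
    intro p q hpq hp1 hq1 hap haq
    have hp1' := hp1
    simp at hp1'
    refine h.false_of_edge hmax hat htu hpq hp1 hq1 haq ?_ (by grind [G.adj_comm])
    intro htp
    by_cases htc : t = c
    · have := h.adj_page_iff hdeg (by grind [G.adj_comm]) p
      grind
    by_cases htd : t = d
    · have := h.swap.adj_page_iff hdeg (by grind [G.adj_comm]) p
      grind
    · have := hTW t p (by simp; grind [G.adj_comm]) hat htp
      grind
  have hW : ∀ x, x ∉ [u, v, c, d, a, b] → G.Adj a x := by
    intro x hx
    by_contra hax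
    have hx' := hx
    simp at hx'
    obtain ⟨y, hy⟩ := (G.degree_pos_iff_exists_adj x).1 (hpos x)
    by_cases hay : G.Adj a y
    · by_cases hyc : y = c
      · have := h.adj_page_iff hdeg (by grind [G.adj_comm]) x
        grind [G.adj_comm]
      by_cases hyd : y = d
      · have := h.swap.adj_page_iff hdeg (by grind [G.adj_comm]) x
        grind [G.adj_comm]
      · have := hTW y x (by simp; grind [G.adj_comm]) hay hy.symm
        grind
    · exact hR x y hy (by simp; grind) (by simp; grind [G.adj_comm]) hax hay
  by_cases hac : G.Adj a c
  · exact h.exists_book_of_not_adj_of_adj_page hdeg hab hac hW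
  by_cases had : G.Adj a d
  · exact h.swap.exists_book_of_not_adj_of_adj_page hdeg hab had
      (fun x hx => hW x (by simp at hx ⊢; grind))
  have ht : t ∉ [u, v, c, d, a, b] := by simp; grind [G.adj_comm]
  have ht' := ht
  simp at ht'
  -- Every outer vertex is a neighbour of `a`. So either there are two of them, to be handed to `d`,
  -- or `t` is the only one and the graph realizes `(4^2, 2^5)`.
  by_cases hs : ∃ s, s ≠ u ∧ s ≠ t ∧ G.Adj a s
  · obtain ⟨s, hsu, hst, has⟩ := hs
    have hs : s ∉ [u, v, c, d, a, b] := by simp; grind [G.adj_comm]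
    refine Or.inl (h.book_of_two_outer (w := t) (t := s) ?_ hat has ?_ ?_)
    · simp at hs ⊢; grind
    · intro hd
      have := hTW t d ht hat hd.symm
      grind
    · intro hd
      have := hTW s d hs has hd.symm
      grind
  · push Not at hs
    right
    have hall : ∀ x, x ∈ [u, v, c, d, a, b, t] := by
      intro x
      by_contra hx
      simp at hx
      have := hW x (by simp; grind)
      grind
    have hall' := hall
    simp at hall'
    have htd : ¬ G.Adj t d := fun hd => by
      have := hTW t d ht hat hd
      grind
    have htc : ¬ G.Adj t c := fun hd => by
      have := hTW t c ht hat hd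
      grind
    have hcd : ¬ G.Adj c d := fun hd => hR c d hd (by simp; grind) (by simp; grind) hac had
    refine ⟨[u, v, c, d, a, b, t], by simp; grind, hall, Or.inr (Or.inl ?_)⟩
    have e1 : G.degree u = 4 := degree_eq_length_of_adj_iff [v, c, d, a] (by simp; grind)
      (by simpa using hu)
    have e2 : G.degree v = 4 := degree_eq_length_of_adj_iff [u, c, d, b] (by simp; grind)
      (by simpa using hv)
    have e3 : G.degree c = 2 := degree_eq_length_of_adj_iff [u, v] (by simp; grind)
      (by simp; intro y; have := hall' y; grind [G.adj_comm])
    have e4 : G.degree d = 2 := degree_eq_length_of_adj_iff [u, v] (by simp; grind)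
      (by simp; intro y; have := hall' y; grind [G.adj_comm])
    have e5 : G.degree a = 2 := degree_eq_length_of_adj_iff [u, t] (by simp; grind)
      (by simp; intro y; have := hall' y; grind [G.adj_comm])
    have e6 : G.degree b = 2 := degree_eq_length_of_adj_iff [v, t] (by simp; grind)
      (by simp; intro y; have := hall' y; grind [G.adj_comm])
    have e7 : G.degree t = 2 := degree_eq_length_of_adj_iff [a, b] (by simp; grind)
      (by simp; intro y; have := hall' y; grind [G.adj_comm])
    simp [e1, e2, e3, e4, e5, e6, e7]

open Classical in
-- If `a` is joined to `d` as well, all six core vertices are saturated, and an outer vertex would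
-- lie on an edge forbidden by `hR`; this leaves `(4^6)`. If not, an exchange applies, whether or
-- not `a` has an outer neighbour.
theorem exists_book_of_adj_of_adj_page (h : G.IsCore u v a b c d)
    (hdeg : ∀ x, G.degree x ≤ 4) (hpos : ∀ x, 0 < G.degree x) (hab : G.Adj a b) (hac : G.Adj a c)
    (hR : ∀ p q, G.Adj p q → p ∉ [u, v, a, b] → q ∉ [u, v, a, b] → ¬ G.Adj a p →
      ¬ G.Adj a q → False) :
    (∃ H, SameDegrees G H ∧ H.HasBook) ∨ IsExceptional G := by
  have hn := h.nodup
  have hu := h.adj_left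
  have hv := h.adj_right
  have hp := h.adj_private
  simp at hn
  have hirr : ∀ x, ¬ G.Adj x x := fun x => G.irrefl
  have hc := h.adj_page_iff hdeg hac
  by_cases had : G.Adj a d
  · have hd := h.swap.adj_page_iff hdeg had
    have ha : ∀ y, G.Adj a y ↔ y ∈ [u, b, c, d] :=
      adj_iff_mem_of_degree_le [u, b, c, d] (by simp; grind) (by simp; grind [G.adj_comm]) (hdeg a)
    have hb : ∀ y, G.Adj b y ↔ y ∈ [v, a, c, d] :=
      adj_iff_mem_of_degree_le [v, a, c, d] (by simp; grind) (by simp; grind [G.adj_comm]) (hdeg b)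
    have hall : ∀ x, x ∈ [u, v, c, d, a, b] := by
      intro x
      by_contra hx
      simp at hx ha hb
      obtain ⟨y, hy⟩ := (G.degree_pos_iff_exists_adj x).1 (hpos x)
      exact hR x y hy (by simp; grind) (by simp; grind [G.adj_comm]) (by grind)
        (by grind [G.adj_comm])
    right
    refine ⟨[u, v, c, d, a, b], h.nodup, hall, Or.inr (Or.inr (Or.inr ?_))⟩
    have e1 : G.degree u = 4 := degree_eq_length_of_adj_iff [v, c, d, a] (by simp; grind)
      (by simpa using hu)
    have e2 : G.degree v = 4 := degree_eq_length_of_adj_iff [u, c, d, b] (by simp; grind)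
      (by simpa using hv)
    have e3 : G.degree c = 4 := degree_eq_length_of_adj_iff [u, v, a, b] (by simp; grind)
      (by simpa using hc)
    have e4 : G.degree d = 4 := degree_eq_length_of_adj_iff [u, v, a, b] (by simp; grind)
      (by simpa using hd)
    have e5 : G.degree a = 4 := degree_eq_length_of_adj_iff [u, b, c, d] (by simp; grind) ha
    have e6 : G.degree b = 4 := degree_eq_length_of_adj_iff [v, a, c, d] (by simp; grind) hb
    simp [e1, e2, e3, e4, e5, e6]
  left
  by_cases hw : ∃ w, w ∉ [u, v, c, d, a, b] ∧ G.Adj a w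
  · obtain ⟨w, hw, haw⟩ := hw
    simp at hw
    exact h.book_of_page_adj (w := w) (by simp; grind) hac haw had (by grind) (by grind)
  · exact h.book_of_adj_page hab hac had (by grind)

open Classical in
theorem exists_book_of_adj (h : G.IsCore u v a b c d) (hmax : G.IsMaxPair u v)
    (hdeg : ∀ x, G.degree x ≤ 4) (hpos : ∀ x, 0 < G.degree x) (hab : G.Adj a b) :
    (∃ H, SameDegrees G H ∧ H.HasBook) ∨ IsExceptional G := by
  have hn := h.nodup
  have hu := h.adj_left
  have hv := h.adj_right
  have hp := h.adj_private
  simp at hn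
  have hirr : ∀ x, ¬ G.Adj x x := fun x => G.irrefl
  have hub : ¬ G.Adj u b := by grind
  have hva : ¬ G.Adj v a := by grind
  have hbu : ¬ G.Adj b u := fun h' => hub h'.symm
  have hav : ¬ G.Adj a v := fun h' => hva h'.symm
  have hba := hab.symm
  have hR : ∀ p q, G.Adj p q → p ∉ [u, v, a, b] → q ∉ [u, v, a, b] → ¬ G.Adj a p →
      ¬ G.Adj a q → False := by
    intro p q hpq hp1 hq1 hap haq
    have hp1' := hp1
    simp at hp1'
    -- The neighbour `b` of `a` itself plays the part of `t`.
    exact h.false_of_edge hmax hab (by grind) hpq hp1 hq1 haq (by grind) (by grind)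
  by_cases hac : G.Adj a c
  · exact h.exists_book_of_adj_of_adj_page hdeg hpos hab hac hR
  by_cases had : G.Adj a d
  · exact h.swap.exists_book_of_adj_of_adj_page hdeg hpos hab had hR
  have hbc : ¬ G.Adj b c := by grind
  have hbd : ¬ G.Adj b d := by grind
  have hcd : ¬ G.Adj c d := fun hd => hR c d hd (by simp; grind) (by simp; grind) hac had
  have hw₂ : ∀ w, w ∉ [u, v, c, d, a, b] → ¬ (G.Adj c w ∧ G.Adj d w) := fun w hw ⟨h1, h2⟩ =>
    h.false_of_outer hmax hw h1.symm h2.symm (by grind) hac hbd (by grind) (by grind) (by grind)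
  by_cases hw : ∃ w, w ≠ u ∧ w ≠ b ∧ G.Adj a w
  · left
    obtain ⟨w, hwu, hwb, haw⟩ := hw
    have hw : w ∉ [u, v, c, d, a, b] := by simp; grind
    have hw' := hw
    simp at hw'
    by_cases hs : ∃ s, s ≠ u ∧ s ≠ b ∧ s ≠ w ∧ G.Adj a s
    · obtain ⟨s, hsu, hsb, hsw, has⟩ := hs
      have hs : s ∉ [u, v, c, d, a, b] := by simp; grind
      have hs' := hs
      simp at hs'
      have hnd : [u, v, c, a, b, d, w, s].Nodup := by simp; grind
      have hnd₂ : [u, v, d, a, b, c, w, s].Nodup := by simp; grind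
      -- If `c` or `d` misses both `w` and `s`, it can absorb them. Otherwise, by `hw₂`, the edges
      -- from `c, d` to `w, s` form a perfect matching.
      by_cases hd : ¬ G.Adj d w ∧ ¬ G.Adj d s
      · exact h.book_of_two_outer hnd haw has hd.1 hd.2
      by_cases hc : ¬ G.Adj c w ∧ ¬ G.Adj c s
      · exact h.swap.book_of_two_outer hnd₂ haw has hc.1 hc.2
      by_cases hws : G.Adj w s
      · exact h.book_of_adj_outer_adj (w := w) (t := s) (by simp; grind) hab haw has hws
          (by grind) (by grind)
      by_cases hcw : G.Adj c w
      · exact h.book_of_matching hnd haw has hws hcd hcw (by grind)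
      · exact h.swap.book_of_matching hnd₂ haw has hws (fun h' => hcd h'.symm) (by grind) hcw
    · by_cases hdw : G.Adj d w
      · exact h.swap.book_of_adj_outer (w := w) (by simp; grind) hab haw hac (by grind)
      · exact h.book_of_adj_outer (w := w) (by simp; grind) hab haw had hdw
  -- Now `a` and `b` have degree 2 and `hR` forbids outer vertices: the graph realizes `(4^2, 2^4)`.
  · push Not at hw
    right
    have ha : ∀ y, G.Adj a y ↔ y = u ∨ y = b := fun y =>
      ⟨fun hy => by have := hw y; tauto, by grind [G.adj_comm]⟩
    have hb : ∀ y, G.Adj b y ↔ y = v ∨ y = a := by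
      refine fun y => ⟨fun hy => ?_, by grind [G.adj_comm]⟩
      by_contra! hc
      have hyu : y ≠ u := by rintro rfl; exact hbu hy
      have := hp y hyu hc.1 hc.2 hy.ne'
      have := (ha y).1 (this.2 hy)
      exact this.elim hyu hy.ne'
    have hall : ∀ x, x ∈ [u, v, c, d, a, b] := by
      intro x
      by_contra hx
      simp at hx
      obtain ⟨y, hy⟩ := (G.degree_pos_iff_exists_adj x).1 (hpos x)
      exact hR x y hy (by simp; grind) (by simp; grind [G.adj_comm]) (by grind)
        (by grind [G.adj_comm])
    have hall' := hall
    simp at hall'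
    refine ⟨[u, v, c, d, a, b], h.nodup, hall, Or.inl ?_⟩
    have e1 : G.degree u = 4 := degree_eq_length_of_adj_iff [v, c, d, a] (by simp; grind)
      (by simpa using hu)
    have e2 : G.degree v = 4 := degree_eq_length_of_adj_iff [u, c, d, b] (by simp; grind)
      (by simpa using hv)
    have e3 : G.degree c = 2 := degree_eq_length_of_adj_iff [u, v] (by simp; grind)
      (by simp; intro y; have := hall' y; grind [G.adj_comm])
    have e4 : G.degree d = 2 := degree_eq_length_of_adj_iff [u, v] (by simp; grind)
      (by simp; intro y; have := hall' y; grind [G.adj_comm])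
    have e5 : G.degree a = 2 := degree_eq_length_of_adj_iff [u, b] (by simp; grind)
      (by simpa using ha)
    have e6 : G.degree b = 2 := degree_eq_length_of_adj_iff [v, a] (by simp; grind)
      (by simpa using hb)
    simp [e1, e2, e3, e4, e5, e6]

end IsCore

end SimpleGraph

/-! ### Several private neighbours, and reduction to the core -/

namespace SimpleGraph

variable {V : Type*} [Fintype V] {G : SimpleGraph V} {u v a b z : V}

open Classical in
/-- The neighbours of `u` that are neither `v` nor neighbours of `v`. -/
noncomputable def privateNeighbors (G : SimpleGraph V) (u v : V) : Finset V :=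
  {x | G.Adj u x ∧ ¬ G.Adj v x ∧ x ≠ v}

open Classical in
/-- The common neighbours of `u` and `v` as a finite set. -/
noncomputable def sharedNeighbors (G : SimpleGraph V) (u v : V) : Finset V :=
  {x | G.Adj u x ∧ G.Adj v x}

theorem mem_privateNeighbors : a ∈ G.privateNeighbors u v ↔ G.Adj u a ∧ ¬ G.Adj v a ∧ a ≠ v := by
  simp [privateNeighbors]

theorem mem_sharedNeighbors : a ∈ G.sharedNeighbors u v ↔ G.Adj u a ∧ G.Adj v a := by
  simp [sharedNeighbors]

theorem sharedNeighbors_comm : G.sharedNeighbors u v = G.sharedNeighbors v u := by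
  ext x
  simp [mem_sharedNeighbors, and_comm]

open Classical in
theorem degree_eq_card_add_card (h : G.Adj u v) :
    G.degree u = #(G.sharedNeighbors u v) + #(G.privateNeighbors u v) + 1 := by
  have hd : Disjoint (G.sharedNeighbors u v) (G.privateNeighbors u v) := by
    rw [Finset.disjoint_left]
    intro x hx hx'
    rw [mem_sharedNeighbors] at hx
    rw [mem_privateNeighbors] at hx'
    exact hx'.2.1 hx.2
  have hv : v ∉ G.sharedNeighbors u v ∪ G.privateNeighbors u v := by
    simp [mem_sharedNeighbors, mem_privateNeighbors]
  rw [← card_neighborFinset_eq_degree, ← card_union_of_disjoint hd, ← card_insert_of_notMem hv]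
  congr 1
  ext x
  simp only [mem_neighborFinset, mem_insert, mem_union, mem_sharedNeighbors, mem_privateNeighbors]
  by_cases hxv : x = v
  · simp [hxv, h]
  · tauto

theorem IsMaxPair.adj_iff_adj (h : G.IsMaxPair u v) (ha : a ∈ G.privateNeighbors u v)
    (hb : b ∈ G.privateNeighbors v u) (hzu : z ≠ u) (hzv : z ≠ v) (hza : z ≠ a) (hzb : z ≠ b) :
    G.Adj a z ↔ G.Adj b z := by
  rw [mem_privateNeighbors] at ha hb
  exact ⟨h.adj_of_adj ha.1 ha.2.1 hb.1 hb.2.1 ha.2.2 hb.2.2 hzu hzb,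
    h.symm.adj_of_adj hb.1 hb.2.1 ha.1 ha.2.1 hb.2.2 ha.2.2 hzv hza⟩

/-- If a private neighbour `a` of `u`, not the only one, is not joined to a private neighbour of
`v`, then no vertex off `u`, `v` and their neighbours is joined to `a`. -/
theorem IsMaxPair.not_adj_outer (h : G.IsMaxPair u v) {a' : V}
    (ha : a ∈ G.privateNeighbors u v) (ha' : a' ∈ G.privateNeighbors u v) (hne : a ≠ a')
    (hb : b ∈ G.privateNeighbors v u) (hab : ¬ G.Adj a b) {x : V} (hxu : x ≠ u) (hxv : x ≠ v)
    (hux : ¬ G.Adj u x) (hvx : ¬ G.Adj v x) : ¬ G.Adj a x := by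
  intro hax
  have key {a b z : V} := h.adj_iff_adj (a := a) (b := b) (z := z)
  have ma := mem_privateNeighbors.1 ha
  have ma' := mem_privateNeighbors.1 ha'
  have mb := mem_privateNeighbors.1 hb
  have nab : a ≠ b := by rintro rfl; exact ma.2.1 mb.1
  have nab' : a' ≠ b := by rintro rfl; exact ma'.2.1 mb.1
  have nua := ma.1.ne'
  have nua' := ma'.1.ne'
  have k1 : G.Adj b x := (key ha hb hxu hxv hax.ne' (by rintro rfl; exact hvx mb.1)).1 hax
  have k2 : G.Adj a' x := (key ha' hb hxu hxv (by rintro rfl; exact hux ma'.1)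
    (by rintro rfl; exact hvx mb.1)).2 k1
  -- An edge `ba'` would pass to `aa'` by agreement of `a` and `b`, and then to `ba` by agreement of
  -- `a'` and `b`.
  have k3 : ¬ G.Adj b a' := fun hba' =>
    hab ((key ha' hb nua ma.2.2 hne nab).1
      ((key ha hb nua' ma'.2.2 hne.symm nab').2 hba').symm).symm
  exact h.false_of_double_switch ma.1 ma.2.1 mb.1 mb.2.1 ma.2.2 mb.2.2 hxu hxv hux hvx k1.symm
    k2.symm nab'.symm hab k3 nab nab'.symm (fun e => hne e.2.symm)

open Classical in
-- By agreement `c` would be joined to both hubs and to all private neighbours of either. With two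
-- private neighbours of `u` and at most two shared ones, its degree would exceed that of `v`.
theorem IsMaxPair.not_adj_shared (h : G.IsMaxPair u v) (htop : ∀ x ≠ u, G.degree x ≤ G.degree v)
    (hA : 2 ≤ #(G.privateNeighbors u v)) (hC : #(G.sharedNeighbors u v) ≤ 2)
    (ha : a ∈ G.privateNeighbors u v) (hb : b ∈ G.privateNeighbors v u)
    {c : V} (hc : c ∈ G.sharedNeighbors u v) : ¬ G.Adj a c := by
  intro hac
  have key {a b z : V} := h.adj_iff_adj (a := a) (b := b) (z := z)
  have mc := mem_sharedNeighbors.1 hc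
  have ncu := mc.1.ne'
  have ncv := mc.2.ne'
  have kA : ∀ a' ∈ G.privateNeighbors u v, c ≠ a' := by
    rintro a' ha' rfl
    exact (mem_privateNeighbors.1 ha').2.1 mc.2
  have kB : ∀ b' ∈ G.privateNeighbors v u, c ≠ b' := by
    rintro b' hb' rfl
    exact (mem_privateNeighbors.1 hb').2.1 mc.1
  have hbc := (key ha hb ncu ncv (kA a ha) (kB b hb)).1 hac
  have hAc : ∀ a' ∈ G.privateNeighbors u v, G.Adj a' c := fun a' ha' =>
    (key ha' hb ncu ncv (kA a' ha') (kB b hb)).2 hbc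
  have hBc : ∀ b' ∈ G.privateNeighbors v u, G.Adj b' c := fun b' hb' =>
    (key ha hb' ncu ncv (kA a ha) (kB b' hb')).1 hac
  have hd : Disjoint (G.privateNeighbors u v) (G.privateNeighbors v u) := by
    rw [Finset.disjoint_left]
    intro x hx hx'
    exact (mem_privateNeighbors.1 hx).2.1 (mem_privateNeighbors.1 hx').1
  have hsub : insert u (insert v (G.privateNeighbors u v ∪ G.privateNeighbors v u)) ⊆
      G.neighborFinset c := by
    intro x hx
    simp only [mem_insert, mem_union] at hx
    rw [mem_neighborFinset]
    rcases hx with rfl | rfl | hx | hx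
    · exact mc.1.symm
    · exact mc.2.symm
    · exact (hAc x hx).symm
    · exact (hBc x hx).symm
  have hcard := card_le_card hsub
  rw [card_insert_of_notMem, card_insert_of_notMem, card_union_of_disjoint hd,
    card_neighborFinset_eq_degree] at hcard
  · have h1 := htop c ncu
    have h2 := degree_eq_card_add_card h.1.symm
    rw [sharedNeighbors_comm] at h2
    omega
  · simp [mem_privateNeighbors]
  · simp [mem_privateNeighbors, h.1.ne]

open Classical in
-- Both are leaves: a further neighbour of `a` cannot be shared or outer by the two preceding
-- lemmas, and a private one would force the edge `ab` by agreement.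
theorem IsMaxPair.eq_of_adj_private (h : G.IsMaxPair u v)
    (htop : ∀ x ≠ u, G.degree x ≤ G.degree v)
    (hA : 2 ≤ #(G.privateNeighbors u v)) (hC : #(G.sharedNeighbors u v) ≤ 2)
    (ha : a ∈ G.privateNeighbors u v) (hb : b ∈ G.privateNeighbors v u) (hab : ¬ G.Adj a b) :
    (∀ z, G.Adj a z → z = u) ∧ ∀ z, G.Adj b z → z = v := by
  have key {a b z : V} := h.adj_iff_adj (a := a) (b := b) (z := z)
  have ma := mem_privateNeighbors.1 ha
  have mb := mem_privateNeighbors.1 hb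
  obtain ⟨a', ha', hne⟩ := exists_mem_ne (by omega : 1 < #(G.privateNeighbors u v)) a
  have nab : a ≠ b := by rintro rfl; exact ma.2.1 mb.1
  have first : ∀ z, G.Adj a z → z = u := by
    intro z hz
    by_contra hzu
    have hzv : z ≠ v := by rintro rfl; exact ma.2.1 hz.symm
    have hzb : z ≠ b := by rintro rfl; exact hab hz
    have hbz := (key ha hb hzu hzv hz.ne' hzb).1 hz
    by_cases hzc : G.Adj u z
    · by_cases hzc' : G.Adj v z
      · exact h.not_adj_shared htop hA hC ha hb (mem_sharedNeighbors.2 ⟨hzc, hzc'⟩) hz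
      · exact hab ((key (mem_privateNeighbors.2 ⟨hzc, hzc', hzv⟩) hb ma.1.ne' ma.2.2 hz.ne nab).1
          hz.symm).symm
    · by_cases hzc' : G.Adj v z
      · exact hab ((key ha (mem_privateNeighbors.2 ⟨hzc', hzc, hzu⟩) mb.2.2 mb.1.ne' nab.symm
          hzb.symm).2 hbz.symm)
      · exact h.not_adj_outer ha ha' hne.symm hb hab hzu hzv hzc hzc' hz
  refine ⟨first, fun z hz => ?_⟩
  by_contra hzv
  have hzu : z ≠ u := by rintro rfl; exact mb.2.1 hz.symm
  exact hzu (first z ((key ha hb hzu hzv (by rintro rfl; exact hab hz.symm) hz.ne').2 hz))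

open Classical in
-- If `ab` is missing, `a` and `b` are leaves. Some vertex of degree at least 2 is neither a hub nor
-- shared; were it private it would also be a leaf, and were it outer a double switch would apply.
theorem IsMaxPair.adj_private (h : G.IsMaxPair u v)
    (htop : ∀ x ≠ u, G.degree x ≤ G.degree v) (h5 : 5 ≤ #{x | 2 ≤ G.degree x})
    (hA : 2 ≤ #(G.privateNeighbors u v)) (hC : #(G.sharedNeighbors u v) ≤ 2)
    (ha : a ∈ G.privateNeighbors u v) (hb : b ∈ G.privateNeighbors v u) : G.Adj a b := by
  by_contra hab
  have key {a b z : V} := h.adj_iff_adj (a := a) (b := b) (z := z)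
  have ma := mem_privateNeighbors.1 ha
  have mb := mem_privateNeighbors.1 hb
  have nab : a ≠ b := by rintro rfl; exact ma.2.1 mb.1
  obtain ⟨ha1, hb1⟩ := h.eq_of_adj_private htop hA hC ha hb hab
  obtain ⟨x, hx, hxl⟩ : ∃ x, 2 ≤ G.degree x ∧ x ∉ u :: v :: (G.sharedNeighbors u v).toList :=
    exists_notMem_of_card _ (by simp; omega)
  simp at hxl
  obtain ⟨hxu, hxv, hxC⟩ := hxl
  rw [mem_sharedNeighbors] at hxC
  obtain ⟨y, z, hyz, hy, hz⟩ := exists_adj_adj_of_two_le_degree hx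
  by_cases hux : G.Adj u x
  · have mx : x ∈ G.privateNeighbors u v := mem_privateNeighbors.2 ⟨hux, by tauto, hxv⟩
    have hxb : ¬ G.Adj x b := fun e => hxv (hb1 x e.symm)
    have := (h.eq_of_adj_private htop hA hC mx hb hxb).1
    exact hyz ((this y hy).trans (this z hz).symm)
  by_cases hvx : G.Adj v x
  · have mx : x ∈ G.privateNeighbors v u := mem_privateNeighbors.2 ⟨hvx, hux, hxu⟩
    have hax : ¬ G.Adj a x := fun e => hxu (ha1 x e)
    have := (h.eq_of_adj_private htop hA hC ha mx hax).2
    exact hyz ((this y hy).trans (this z hz).symm)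
  exact h.false_of_double_switch ma.1 ma.2.1 mb.1 mb.2.1 ma.2.2 mb.2.2 hxu hxv hux hvx hy hz hyz
    (fun e => hux (ha1 y e ▸ hy).symm) (fun e => hvx (hb1 z e ▸ hz).symm)
    (by rintro rfl; exact hxu (ha1 x hy.symm)) (by rintro rfl; exact hxv (hb1 x hz.symm))
    (by rintro ⟨rfl, rfl⟩; exact hxv (hb1 x hy.symm))

open Classical in
/-- A further private neighbour of `u` produces a book. -/
theorem IsMaxPair.exists_book_of_two_le_card (h : G.IsMaxPair u v)
    (htop : ∀ x ≠ u, G.degree x ≤ G.degree v) (h4 : 4 ≤ G.degree v)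
    (h5 : 5 ≤ #{x | 2 ≤ G.degree x})
    (hA : 2 ≤ #(G.privateNeighbors u v)) (hC : #(G.sharedNeighbors u v) ≤ 2) :
    ∃ H, SameDegrees G H ∧ H.HasBook := by
  have key {a b z : V} := h.adj_iff_adj (a := a) (b := b) (z := z)
  have hBC := degree_eq_card_add_card h.1.symm
  rw [sharedNeighbors_comm] at hBC
  have hadj : ∀ a ∈ G.privateNeighbors u v, ∀ b ∈ G.privateNeighbors v u, G.Adj a b :=
    fun a ha b hb => h.adj_private htop h5 hA hC ha hb
  have hne : ∀ a ∈ G.privateNeighbors u v, ∀ b ∈ G.privateNeighbors v u, a ≠ b :=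
    fun a ha b hb => (hadj a ha b hb).ne
  obtain ⟨a, ha, a', ha', haa'⟩ := one_lt_card.1 hA
  obtain ⟨b, hb⟩ : (G.privateNeighbors v u).Nonempty := card_pos.1 (by omega)
  have ma := mem_privateNeighbors.1 ha
  have ma' := mem_privateNeighbors.1 ha'
  have mb := mem_privateNeighbors.1 hb
  have kaa : G.Adj a a' := (key ha hb ma'.1.ne' ma'.2.2 haa'.symm (hne a' ha' b hb)).2
    (hadj a' ha' b hb).symm
  by_cases hB : 2 ≤ #(G.privateNeighbors v u)
  · obtain ⟨b', hb', hbb'⟩ := exists_mem_ne hB b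
    have mb' := mem_privateNeighbors.1 hb'
    exact ⟨G, fun _ => rfl, a, a', u, b, b', mb.2.2.symm, mb'.2.2.symm, hbb'.symm, kaa, ma.1.symm,
      hadj a ha b hb, hadj a ha b' hb', ma'.1.symm, hadj a' ha' b hb, hadj a' ha' b' hb'⟩
  by_cases ht : ∃ t, t ≠ u ∧ t ≠ b ∧ t ≠ a' ∧ G.Adj a t
  · obtain ⟨t, htu, htb, hta', hat⟩ := ht
    have htv : t ≠ v := by rintro rfl; exact ma.2.1 hat.symm
    have hbt := (key ha hb htu htv hat.ne' htb).1 hat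
    have hat' := (key ha' hb htu htv hta' htb).2 hbt
    exact ⟨G, fun _ => rfl, a, a', u, b, t, mb.2.2.symm, htu.symm, htb.symm, kaa, ma.1.symm,
      hadj a ha b hb, hat, ma'.1.symm, hadj a' ha' b hb, hat'⟩
  push Not at ht
  -- What remains is that `b` is the only private neighbour of `v` and `a` has only the neighbours
  -- `u, b, a'`. The final exchange makes `a, a', b` the pages of `u` and `v`.
  obtain ⟨c, hc, d, hd, hcd⟩ := one_lt_card.1 (by omega : 1 < #(G.sharedNeighbors u v))
  have mc := mem_sharedNeighbors.1 hc
  have md := mem_sharedNeighbors.1 hd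
  have hn : ∀ c ∈ G.sharedNeighbors u v, c ≠ u ∧ c ≠ v ∧ c ≠ a ∧ c ≠ a' ∧ c ≠ b := by
    intro c hc
    have mc := mem_sharedNeighbors.1 hc
    refine ⟨mc.1.ne', mc.2.ne', ?_, ?_, ?_⟩
    · rintro rfl; exact ma.2.1 mc.2
    · rintro rfl; exact ma'.2.1 mc.2
    · rintro rfl; exact mb.2.1 mc.1
  obtain ⟨nc1, nc2, nc3, nc4, nc5⟩ := hn c hc
  obtain ⟨nd1, nd2, nd3, nd4, nd5⟩ := hn d hd
  have kac : ¬ G.Adj a c := ht c nc1 nc5 nc4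
  have kad : ¬ G.Adj a d := ht d nd1 nd5 nd4
  have kbc : ¬ G.Adj b c := fun e => kac ((key ha hb nc1 nc2 nc3 nc5).2 e)
  have kbd : ¬ G.Adj b d := fun e => kad ((key ha hb nd1 nd2 nd3 nd5).2 e)
  have kad' : ¬ G.Adj a' d := fun e => kbd ((key ha' hb nd1 nd2 nd4 nd5).1 e)
  have n1 := h.1.ne
  have n2 := ma.1.ne
  have n3 := ma'.1.ne
  have n4 := mb.1.ne
  have n5 := hne a ha b hb
  have n6 := hne a' ha' b hb
  have kab := hadj a ha b hb
  have kab' := hadj a' ha' b hb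
  have huv := h.1
  clear key hadj hne hn ht h5 htop hBC hA hB hC
  refine exists_book_of_exchange (k := 2) (l := [u, v, a, a', b, c, d]) rfl (by simp; grind)
    [(0, 6), (1, 5), (1, 6), (2, 3), (2, 4), (3, 4)]
    [(0, 4), (1, 2), (1, 3), (2, 6), (3, 6), (4, 5)]
    (by decide) (by decide) ?_ ?_ ?_ <;>
  simp <;> grind [G.adj_comm]

open Classical in
theorem IsMaxPair.exists_book (h : G.IsMaxPair u v) (hle : G.degree v ≤ G.degree u)
    (htop : ∀ x ≠ u, G.degree x ≤ G.degree v) (h4 : 4 ≤ G.degree v)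
    (h5 : 5 ≤ #{x | 2 ≤ G.degree x}) (hpos : ∀ x, 0 < G.degree x) :
    (∃ H, SameDegrees G H ∧ H.HasBook) ∨ IsExceptional G := by
  by_cases hC : 3 ≤ #(G.sharedNeighbors u v)
  · obtain ⟨x, y, z, hx, hy, hz, hxy, hxz, hyz⟩ := two_lt_card_iff.1 hC
    rw [mem_sharedNeighbors] at hx hy hz
    exact Or.inl ⟨G, fun _ => rfl, u, v, x, y, z, hxy, hxz, hyz, h.1, hx.1, hy.1, hz.1, hx.2, hy.2,
      hz.2⟩
  by_cases hA : 2 ≤ #(G.privateNeighbors u v)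
  · exact Or.inl (h.exists_book_of_two_le_card htop h4 h5 hA (by omega))
  have hu := degree_eq_card_add_card h.1
  have hv := degree_eq_card_add_card h.1.symm
  rw [sharedNeighbors_comm] at hv
  -- With at most two shared neighbours and at most one private neighbour of `u`, the inequalities
  -- `4 ≤ deg v ≤ deg u` force the counts 2, 1, 1 and both degrees 4.
  obtain ⟨a, ha⟩ := card_eq_one.1 (by omega : #(G.privateNeighbors u v) = 1)
  obtain ⟨b, hb⟩ := card_eq_one.1 (by omega : #(G.privateNeighbors v u) = 1)
  obtain ⟨c, d, hcd, hc⟩ := card_eq_two.1 (by omega : #(G.sharedNeighbors u v) = 2)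
  have hdeg : ∀ x, G.degree x ≤ 4 := by
    intro x
    by_cases hx : x = u
    · subst hx; omega
    · have := htop x hx; omega
  have ea : ∀ x, (G.Adj u x ∧ ¬ G.Adj v x ∧ x ≠ v) ↔ x = a := fun x => by
    rw [← mem_privateNeighbors, ha, mem_singleton]
  have eb : ∀ x, (G.Adj v x ∧ ¬ G.Adj u x ∧ x ≠ u) ↔ x = b := fun x => by
    rw [← mem_privateNeighbors, hb, mem_singleton]
  have ec : ∀ x, (G.Adj u x ∧ G.Adj v x) ↔ x = c ∨ x = d := fun x => by
    rw [← mem_sharedNeighbors, hc, mem_insert, mem_singleton]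
  have huv := h.1
  have hvu := h.1.symm
  have hiu : ¬ G.Adj u u := G.irrefl
  have hiv : ¬ G.Adj v v := G.irrefl
  have hcore : G.IsCore u v a b c d := by
    refine ⟨?_, fun x => ?_, fun x => ?_, fun x h1 h2 h3 h4 => ?_⟩
    · have := (ea a).2 rfl
      have := (eb b).2 rfl
      have := (ec c).2 (Or.inl rfl)
      have := (ec d).2 (Or.inr rfl)
      simp
      grind
    · have := ea x
      have := ec x
      by_cases hxv : x = v
      · simp [hxv, huv]
      · tauto
    · have := eb x
      have := ec x
      by_cases hxu : x = u
      · simp [hxu, hvu]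
      · tauto
    · exact h.adj_iff_adj (by simp [ha]) (by simp [hb]) h1 h2 h3 h4
  by_cases hab : G.Adj a b
  · exact hcore.exists_book_of_adj h hdeg hpos hab
  · exact hcore.exists_book_of_not_adj h hdeg hpos h5 hab

end SimpleGraph

/-! ### A suitable edge between the two largest degrees -/

namespace SimpleGraph

variable {V : Type*} [Fintype V] {G : SimpleGraph V}

open Classical in
theorem exists_adj_of_top {u v : V} (huv : u ≠ v) (htop : ∀ x ≠ u, G.degree x ≤ G.degree v)
    (hpos : 0 < G.degree u) : ∃ H, SameDegrees G H ∧ H.Adj u v := by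
  by_cases h : G.Adj u v
  · exact ⟨G, fun _ => rfl, h⟩
  obtain ⟨x, hx⟩ := (G.degree_pos_iff_exists_adj u).1 hpos
  have hxv : x ≠ v := by rintro rfl; exact h hx
  -- The degree of `x` is at most that of `v`, but `u` is a neighbour of `x` and not of `v`; so `v`
  -- has a neighbour that `x` lacks. Then `ux`, `vz` are switched into `uv`, `xz`.
  obtain ⟨z, hz, hzx⟩ : ∃ z ∈ (G.neighborFinset v).erase x, z ∉ (G.neighborFinset x).erase v := by
    by_contra! hc
    have h1 : insert u ((G.neighborFinset v).erase x) ⊆ (G.neighborFinset x).erase v := by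
      intro y hy
      rcases mem_insert.1 hy with rfl | hy
      · simp [huv, hx.symm]
      · exact hc y hy
    have h2 := card_le_card h1
    rw [card_insert_of_notMem (by simpa using fun _ e => h (G.adj_symm e))] at h2
    have h3 := htop x hx.ne'
    rw [← card_neighborFinset_eq_degree, ← card_neighborFinset_eq_degree] at h3
    by_cases hvx : G.Adj v x
    · rw [card_erase_of_mem (by simpa using hvx), card_erase_of_mem (by simpa using hvx.symm)] at h2
      omega
    · rw [erase_eq_of_notMem (by simpa using hvx),
        erase_eq_of_notMem (by simpa using fun e => hvx (G.adj_symm e))] at h2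
      omega
  simp at hz hzx
  have hxz : ¬ G.Adj x z := fun e => hzx (hz.2.ne') e
  obtain ⟨H, hH, hadj⟩ := exists_switch hx hz.2 h hxz huv (Ne.symm hz.1)
  exact ⟨H, hH, (hadj u v).2 (Or.inr (Or.inl ⟨rfl, rfl⟩))⟩

open Classical in
theorem exists_isMaxPair {u v : V} (h : G.Adj u v) : ∃ H, SameDegrees G H ∧ H.IsMaxPair u v := by
  obtain ⟨H, hH, hmax⟩ := Set.exists_max_image {H : SimpleGraph V | SameDegrees G H ∧ H.Adj u v}
    (fun H => (H.commonNeighbors u v).ncard) (Set.toFinite _) ⟨G, fun _ => rfl, h⟩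
  exact ⟨H, hH.1, hH.2, fun K hK hKuv => hmax K ⟨hH.1.trans hK, hKuv⟩⟩

open Classical in
/-- A graph in which the two largest degrees are at least `4`, five degrees are at least `2` and
none is `0` has the degrees of a graph with a book, unless it is exceptional. -/
theorem exists_sameDegrees_hasBook {u v : V} (huv : u ≠ v) (hle : G.degree v ≤ G.degree u)
    (htop : ∀ x ≠ u, G.degree x ≤ G.degree v) (h4 : 4 ≤ G.degree v)
    (h5 : 5 ≤ #{x | 2 ≤ G.degree x}) (hpos : ∀ x, 0 < G.degree x) :
    (∃ H, SameDegrees G H ∧ H.HasBook) ∨ IsExceptional G := by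
  obtain ⟨G₁, h1, hadj⟩ := exists_adj_of_top huv htop (hpos u)
  obtain ⟨G₂, h2, hmax⟩ := exists_isMaxPair hadj
  have hd : ∀ x, G₂.degree x = G.degree x := h1.trans h2
  have := hmax.exists_book (by simpa [hd] using hle) (by simpa [hd] using htop)
    (by simpa [hd] using h4) (by simpa [hd] using h5) (by simpa [hd] using hpos)
  refine this.imp (fun ⟨H, hH, hb⟩ => ⟨H, (h1.trans h2).trans hH, hb⟩) ?_
  rintro ⟨l, hl, hall, h⟩
  exact ⟨l, hl, hall, by simpa [hd] using h⟩

/-! ### Books as copies of `K_5 - K_3`, and the degree obstruction -/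

theorem K5MinusK3_adj {i j : Fin 5} :
    K5MinusK3.Adj i j ↔ i ≠ j ∧ (3 ≤ (i : ℕ) ∨ 3 ≤ (j : ℕ)) := by
  simp only [K5MinusK3, sdiff_adj, top_adj, map_adj, and_congr_right_iff]
  refine fun hij => ⟨fun h => ?_, ?_⟩
  · by_contra! hc
    exact h ⟨⟨i, hc.1⟩, ⟨j, hc.2⟩, fun e => hij (by simpa [Fin.ext_iff] using e), rfl, rfl⟩
  · rintro h ⟨a, b, -, rfl, rfl⟩
    simp at h
    omega

theorem hasBook_iff {V : Type*} {G : SimpleGraph V} : G.HasBook ↔ K5MinusK3.IsContained G := by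
  constructor
  · rintro ⟨u, v, x, y, z, hxy, hxz, hyz, huv, hux, huy, huz, hvx, hvy, hvz⟩
    have h1 := huv.ne
    have h2 := hux.ne
    have h3 := huy.ne
    have h4 := huz.ne
    have h5 := hvx.ne
    have h6 := hvy.ne
    have h7 := hvz.ne
    -- The removed triangle is on `0, 1, 2`, so these indices are the pages and `3, 4` the hubs.
    refine ⟨⟨⟨![x, y, z, u, v], ?_⟩, ?_⟩⟩
    · intro i j hij
      rw [K5MinusK3_adj] at hij
      fin_cases i <;> fin_cases j <;> simp at hij ⊢ <;>
        first | assumption | (apply SimpleGraph.Adj.symm; assumption)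
    · intro i j hij
      fin_cases i <;> fin_cases j <;> simp_all
  · rintro ⟨f⟩
    have hadj : ∀ i j : Fin 5, i ≠ j → 3 ≤ (j : ℕ) → G.Adj (f i) (f j) := by
      intro i j hij hj
      exact f.toHom.map_adj (K5MinusK3_adj.2 ⟨hij, Or.inr hj⟩)
    have hinj := f.injective
    exact ⟨f 3, f 4, f 0, f 1, f 2, hinj.ne (by decide), hinj.ne (by decide), hinj.ne (by decide),
      hadj _ _ (by decide) (by decide), (hadj _ _ (by decide) (by decide)).symm,
      (hadj _ _ (by decide) (by decide)).symm, (hadj _ _ (by decide) (by decide)).symm,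
      (hadj _ _ (by decide) (by decide)).symm, (hadj _ _ (by decide) (by decide)).symm,
      (hadj _ _ (by decide) (by decide)).symm⟩

open Classical in
/-- With hubs of degree `4`, a vertex off the book is joined only to non-hubs that are off the book
or have degree at least `3`. -/
theorem degree_bounds_of_book {u v x y z w : V} (hxy : x ≠ y) (hxz : x ≠ z) (hyz : y ≠ z)
    (huv : G.Adj u v) (hux : G.Adj u x) (huy : G.Adj u y) (huz : G.Adj u z) (hvx : G.Adj v x)
    (hvy : G.Adj v y) (hvz : G.Adj v z) (hu : G.degree u ≤ 4) (hv : G.degree v ≤ 4)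
    (hw : w ∉ [u, v, x, y, z]) :
    G.degree w + 2 ≤ Fintype.card V - 6 + #{t | 3 ≤ G.degree t} ∧
      G.degree w + 3 ≤ Fintype.card V := by
  have hw' := hw
  simp at hw'
  have n1 := huv.ne
  have n2 := hux.ne
  have n3 := huy.ne
  have n4 := huz.ne
  have n5 := hvx.ne
  have n6 := hvy.ne
  have n7 := hvz.ne
  have Nu := adj_iff_mem_of_degree_le (G := G) (x := u) [v, x, y, z] (by simp; grind)
    (by simp; tauto) hu
  have Nv := adj_iff_mem_of_degree_le (G := G) (x := v) [u, x, y, z] (by simp; grind)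
    (by simp; refine ⟨huv.symm, ?_⟩; tauto) hv
  have hwu : ¬ G.Adj w u := fun e => by
    have := (Nu w).1 e.symm
    simp at this
    tauto
  have hwv : ¬ G.Adj w v := fun e => by
    have := (Nv w).1 e.symm
    simp at this
    tauto
  have du : 3 ≤ G.degree u := by
    rw [degree_eq_length_of_adj_iff [v, x, y, z] (by simp; grind) Nu]; simp
  have dv : 3 ≤ G.degree v := by
    rw [degree_eq_length_of_adj_iff [u, x, y, z] (by simp; grind) Nv]; simp
  -- A page of degree at most 2 has no neighbours besides the hubs.
  have hpage : ∀ p, G.Adj u p → G.Adj v p → G.Adj w p → 3 ≤ G.degree p := by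
    intro p h1 h2 h3
    by_contra! hc
    have := adj_iff_mem_of_degree_le (G := G) (x := p) [u, v] (by simp; grind)
      (by simp [h1.symm, h2.symm]) (by simp; omega) w
    have := this.1 h3.symm
    simp at this
    tauto
  rw [← card_neighborFinset_eq_degree (v := w)]
  constructor
  · have hsub : G.neighborFinset w ⊆
        (univ \ [u, v, x, y, z, w].toFinset) ∪ ((univ.filter (3 ≤ G.degree ·)) \ {u, v}) := by
      intro t ht
      rw [mem_neighborFinset] at ht
      have htu : t ≠ u := by rintro rfl; exact hwu ht
      have htv : t ≠ v := by rintro rfl; exact hwv ht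
      have htw : t ≠ w := ht.ne'
      by_cases hp : t = x ∨ t = y ∨ t = z
      · have : 3 ≤ G.degree t := by
          rcases hp with rfl | rfl | rfl
          · exact hpage _ hux hvx ht
          · exact hpage _ huy hvy ht
          · exact hpage _ huz hvz ht
        simp [htu, htv, this]
      · simp at hp
        simp [htu, htv, htw, hp]
    have h1 := (card_le_card hsub).trans (card_union_le _ _)
    rw [card_sdiff_of_subset (subset_univ _), card_sdiff_of_subset (by
      intro t ht
      simp only [mem_insert, mem_singleton] at ht
      rcases ht with rfl | rfl <;> simpa), card_pair n1,
      List.toFinset_card_of_nodup (by simp; grind), card_univ] at h1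
    have h2 : 2 ≤ #(univ.filter (3 ≤ G.degree ·)) := by
      rw [← card_pair n1]
      apply card_le_card
      intro t ht
      simp only [mem_insert, mem_singleton] at ht
      rcases ht with rfl | rfl <;> simpa
    simp only [List.length_cons, List.length_nil] at h1
    omega
  · have hsub : G.neighborFinset w ⊆ univ \ {u, v, w} := by
      intro t ht
      rw [mem_neighborFinset] at ht
      have htu : t ≠ u := by rintro rfl; exact hwu ht
      have htv : t ≠ v := by rintro rfl; exact hwv ht
      simp [htu, htv, ht.ne']
    have h1 := card_le_card hsub
    have h3 : #({u, v, w} : Finset V) = 3 := card_eq_three.2 ⟨u, v, w, n1, by tauto, by tauto, rfl⟩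
    have h2 := card_le_card (subset_univ ({u, v, w} : Finset V))
    rw [card_sdiff_of_subset (subset_univ _), h3, card_univ] at h1
    rw [h3, card_univ] at h2
    omega

end SimpleGraph

/-! ### From graphs to degree sequences -/

open Classical in
theorem SimpleGraph.length_le_degree {V : Type*} [Fintype V] {G : SimpleGraph V} {x : V}
    (l : List V) (hl : l.Nodup) (h : ∀ y ∈ l, G.Adj x y) : l.length ≤ G.degree x := by
  rw [← card_neighborFinset_eq_degree, ← List.toFinset_card_of_nodup hl]
  exact card_le_card fun y hy => by simpa using h y (by simpa using hy)

theorem isPotentiallyGraphic_K5MinusK3_iff {n : ℕ} {d : Fin n → ℕ} :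
    IsPotentiallyGraphic K5MinusK3 d ↔
      Antitone d ∧ ∃ G : SimpleGraph (Fin n), IsRealization G d ∧ G.HasBook := by
  simp only [IsPotentiallyGraphic, SimpleGraph.hasBook_iff]

open Classical in
theorem isRealization_iff {n : ℕ} {G : SimpleGraph (Fin n)} {d : Fin n → ℕ} :
    IsRealization G d ↔ ∀ i, G.degree i = d i := by
  simp only [IsRealization]

/-- Both lists are non-increasing and permutations of each other, hence equal. -/
theorem ofFn_eq_of_map_eq {n : ℕ} {d : Fin n → ℕ} (hd : Antitone d) {l : List (Fin n)}
    (hl : l.Nodup) (hall : ∀ x, x ∈ l) {m : List ℕ} (hm : m.Pairwise (· ≥ ·))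
    (h : l.map d = m) : List.ofFn d = m := by
  have hp : l.Perm (List.finRange n) :=
    (List.perm_ext_iff_of_nodup hl (List.nodup_finRange n)).2 fun x => by simp [hall]
  refine List.Perm.eq_of_pairwise (le := (· ≥ ·)) (fun a b _ _ h1 h2 => le_antisymm h2 h1) ?_ hm ?_
  · rw [List.pairwise_ofFn]
    exact fun i j hij => hd hij.le
  · rw [← h, List.ofFn_eq_map]
    exact (hp.map d).symm

open Classical in
/-- Realizations of the exceptional sequences contain no book. -/
theorem not_hasBook_of_card {n : ℕ} {G : SimpleGraph (Fin n)} (hn : 6 ≤ n)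
    (h2 : ∀ i, 2 ≤ G.degree i) (h4 : ∀ i, G.degree i ≤ 4)
    (h : n - 6 + #{t | 3 ≤ G.degree t} < 4 ∨ (n = 6 ∧ ∀ i, 4 ≤ G.degree i)) : ¬ G.HasBook := by
  rintro ⟨u, v, x, y, z, hxy, hxz, hyz, huv, hux, huy, huz, hvx, hvy, hvz⟩
  obtain ⟨w, hw⟩ : ∃ w, w ∉ [u, v, x, y, z] := by
    by_contra! hc
    have := (card_le_card (fun w _ => by simpa using hc w : univ ⊆ [u, v, x, y, z].toFinset)).trans
      (List.toFinset_card_le _)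
    simp at this
    omega
  have := SimpleGraph.degree_bounds_of_book hxy hxz hyz huv hux huy huz hvx hvy hvz (h4 u) (h4 v) hw
  rw [Fintype.card_fin] at this
  have hw2 := h2 w
  rcases h with h | ⟨h, h'⟩
  · omega
  · have := h' w
    omega

theorem theorem3p3 {n : ℕ} (hn : 5 ≤ n) (d : Fin n → ℕ) (hd : IsGraphic d)
    (hpos : ∀ i, 0 < d i) :
    IsPotentiallyGraphic K5MinusK3 d ↔
      (4 ≤ d ⟨1, by omega⟩ ∧ 2 ≤ d ⟨4, by omega⟩) ∧
      (List.ofFn d ≠ [4, 4, 2, 2, 2, 2] ∧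
        List.ofFn d ≠ [4, 4, 2, 2, 2, 2, 2] ∧
        List.ofFn d ≠ [4, 4, 4, 2, 2, 2] ∧
        List.ofFn d ≠ [4, 4, 4, 4, 4, 4]) := by
  classical
  obtain ⟨hanti, G, hG⟩ := hd
  rw [isPotentiallyGraphic_K5MinusK3_iff]
  constructor
  · rintro ⟨-, G, hG, hbook⟩
    rw [isRealization_iff] at hG
    refine ⟨?_, ?_⟩
    · obtain ⟨u, v, x, y, z, hxy, hxz, hyz, huv, hux, huy, huz, hvx, hvy, hvz⟩ := hbook
      have n1 := huv.ne
      have n2 := hux.ne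
      have n3 := huy.ne
      have n4 := huz.ne
      have n5 := hvx.ne
      have n6 := hvy.ne
      have n7 := hvz.ne
      have du : 4 ≤ d u := by
        rw [← hG]
        exact SimpleGraph.length_le_degree [v, x, y, z] (by simp; tauto) (by simp; tauto)
      have dv : 4 ≤ d v := by
        rw [← hG]
        exact SimpleGraph.length_le_degree [u, x, y, z] (by simp; tauto)
          (by simp; exact ⟨huv.symm, hvx, hvy, hvz⟩)
      have dp : ∀ p, G.Adj u p → G.Adj v p → 2 ≤ d p := by
        intro p h1 h2
        rw [← hG]
        exact SimpleGraph.length_le_degree [u, v] (by simpa) (by simp [h1.symm, h2.symm])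
      have dx := dp x hux hvx
      have dy := dp y huy hvy
      have dz := dp z huz hvz
      simp only [ne_eq, Fin.ext_iff] at n1 n2 n3 n4 n5 n6 n7 hxy hxz hyz
      constructor
      · by_contra! hc
        -- By monotonicity only index 0 could carry a degree of at least 4, but there are two hubs.
        have key : ∀ p : Fin n, 4 ≤ d p → (p : ℕ) = 0 := by
          intro p hp
          by_contra h0
          have : d p ≤ d ⟨1, by omega⟩ := hanti (Fin.mk_le_of_le_val (by omega))
          omega
        have := key u du
        have := key v dv
        omega
      · by_contra! hc
        have key : ∀ p : Fin n, 2 ≤ d p → (p : ℕ) < 4 := by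
          intro p hp
          by_contra h0
          have : d p ≤ d ⟨4, by omega⟩ := hanti (Fin.mk_le_of_le_val (by omega))
          omega
        have := key u (by omega)
        have := key v (by omega)
        have := key x dx
        have := key y dy
        have := key z dz
        omega
    · refine ⟨fun h => ?_, fun h => ?_, fun h => ?_, fun h => ?_⟩
      all_goals
        have hlen := congrArg List.length h
        simp only [List.length_ofFn, List.length_cons, List.length_nil, zero_add] at hlen
        norm_num at hlen
        subst hlen
      · obtain rfl : d = ![4, 4, 2, 2, 2, 2] := List.ofFn_injective (by simpa using h)
        refine not_hasBook_of_card (by omega) ?_ ?_ (Or.inl ?_) hbook <;> simp only [hG] <;> decide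
      · obtain rfl : d = ![4, 4, 2, 2, 2, 2, 2] := List.ofFn_injective (by simpa using h)
        refine not_hasBook_of_card (by omega) ?_ ?_ (Or.inl ?_) hbook <;> simp only [hG] <;> decide
      · obtain rfl : d = ![4, 4, 4, 2, 2, 2] := List.ofFn_injective (by simpa using h)
        refine not_hasBook_of_card (by omega) ?_ ?_ (Or.inl ?_) hbook <;> simp only [hG] <;> decide
      · obtain rfl : d = ![4, 4, 4, 4, 4, 4] := List.ofFn_injective (by simpa using h)
        refine not_hasBook_of_card (by omega) ?_ ?_ (Or.inr ⟨rfl, ?_⟩) hbook <;> simp only [hG] <;>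
          decide
  · rintro ⟨⟨h1, h4⟩, e1, e2, e3, e4⟩
    rw [isRealization_iff] at hG
    refine ⟨hanti, ?_⟩
    have h5 : 5 ≤ #{x | 2 ≤ G.degree x} := by
      -- The first five indices have degree at least 2, by monotonicity from the fifth term.
      have hsub : univ.map (Fin.castLEEmb hn) ⊆ ({x | 2 ≤ G.degree x} : Finset (Fin n)) := by
        intro x hx
        obtain ⟨i, -, rfl⟩ := mem_map.1 hx
        simp only [mem_filter, mem_univ, true_and, hG]
        exact h4.trans (hanti (Fin.le_def.2 (by simp; omega)))
      simpa using card_le_card hsub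
    rcases SimpleGraph.exists_sameDegrees_hasBook (G := G) (u := ⟨0, by omega⟩) (v := ⟨1, by omega⟩)
      (by simp) (by simp only [hG]; exact hanti (Fin.le_def.2 (by simp)))
      (fun x hx => by
        simp only [hG]
        refine hanti (Fin.le_def.2 ?_)
        simp only [ne_eq, Fin.ext_iff] at hx
        simp only
        omega)
      (by simpa only [hG] using h1) h5 (by simpa only [hG] using hpos) with
      ⟨H, hH, hbook⟩ | ⟨l, hl, hall, h⟩
    · exact ⟨H, isRealization_iff.2 fun i => (hH i).trans (hG i), hbook⟩
    · exfalso
      simp only [hG] at h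
      rcases h with h | h | h | h
      · exact e1 (ofFn_eq_of_map_eq hanti hl hall (by decide) h)
      · exact e2 (ofFn_eq_of_map_eq hanti hl hall (by decide) h)
      · exact e3 (ofFn_eq_of_map_eq hanti hl hall (by decide) h)
      · exact e4 (ofFn_eq_of_map_eq hanti hl hall (by decide) h)
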